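/- **Setting.** Let a group $G$ act transitively on a set $M$ from the left, let $m_0\in M$, and for each $m\in M$ let $g_{m_0,m}\in G$ satisfy $g_{m_0,m}\cdot m_0=m$; these data form a *cell space* $\mathcal R$. Let $G_0$ be the stabiliser of $m_0$, and assume that it is finite. For $m\in M$ and $gG_0\in G/G_0$ put $m\triangleleft gG_0=g_{m_0,m}\,g\,g_{m_0,m}^{-1}\cdot m=g_{m_0,m}\,g\cdot m_0$. Identify $M$ with $G/G_0$ by $m\mapsto g_{m_0,m}G_0$, so that $m\triangleleft n=g_{m_0,m}\cdot n$ for $m,n\in M$. Assume that $\mathcal R$ is *right amenable*: there is a finitely additive probability measure $\mu$ on the power set of $M$ such that $\mu(A\triangleleft\mathfrak g)=\mu(A)$ for all $\mathfrak g\in G/G_0$ and $A\subseteq M$ for which $m\mapsto m\triangleleft\mathfrak g$ is injective on $A$. Assume that $\mathcal R$ is *finitely right generated* and let $S\subseteq G/G_0$ be a finite symmetric right generating set, i.e. $S$ is finite, $G_0\cdot S\subseteq S$, $S^{-1}:=\{g^{-1}G_0 : gG_0\in S\}\subseteq S$, and each $m\in M$ is of the form $((m_0\triangleleft s_1)\triangleleft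 s_2)\cdots\triangleleft s_k$ with $k\ge 0$ and $s_1,\dots,s_k\in S\cup S^{-1}$. Let $d$ be the path metric on $M$ of the graph with edges from $m$ to $m\triangleleft s$ ($m\in M$, $s\in S$). Put $B(m,\rho)=\{m' : d(m,m')\le\rho\}$ and, for sets of cells, $d(A,B)=\inf_{a\in A,\,b\in B}d(a,b)$ (with $\inf\emptyset=\infty$). For $A\subseteq M$ put $\partial_\rho A=\{m\in M : B(m,\rho)\cap A\ne\emptyset\}\smallsetminus\{m\in A : B(m,\rho)\subseteq A\}$. Let $\mathcal F=(F_i)_{i\in I}$ be a *right Følner net*, i.e. a net of non-empty finite subsets of $M$, indexed by a non-empty directed set, such that $\lim_i|\partial_\rho F_i|/|F_i|=0$ for each integer $\rho\ge0$. Let $H$ be a subgroup of $G$ that contains all $g_{m_0,m}$, $m\in M$, let $H_0=H\cap G_0$, and let $Q$ be a finite set. **Subshifts.** For $A\subseteq M$, an $A$-pattern is a map $p\colon A\to Q$; it is a *block* if $A$ is finite. It *semi-occurs* in $c\in Q^M$ if there is an $h\in H$ with $c(h\cdot a)=p(a)$ for all $a\in A$. It is *allowed* in $X\subseteq Q^M$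 if it semi-occurs in some $x\in X$. A *subshift* of $Q^M$ is a set of the form $\{c\in Q^M : \text{no }\mathfrak f\in\mathfrak F\text{ semi-occurs in }c\}$ for a set $\mathfrak F$ of blocks, and it is *of finite type* if $\mathfrak F$ can be chosen finite. A subshift $X$ is *strongly irreducible* if there is an integer $\kappa\ge0$ such that, for any two blocks $p\in Q^A$ and $p'\in Q^{A'}$ that are allowed in $X$ and satisfy $d(A,A')\ge\kappa+1$, there is an $x\in X$ with $x|_A=p$ and $x|_{A'}=p'$. For $A\subseteq M$ let $X_A=\{x|_A : x\in X\}$. The *$\mathcal F$-entropy* of a non-empty $X$ is $\operatorname{ent}_{\mathcal F}(X)=\limsup_{i\in I}\log|X_{F_i}|/|F_i|$. **Local maps.** For subshifts $X,Y$ of $Q^M$, a map $\Delta\colon X\to Y$ is *local* if there are an integer $\kappa\ge0$, a set $N\subseteq B(m_0,\kappa)$ with $G_0\cdot N\subseteq N$, and a map $\delta\colon X_N\to Q$ with $\delta(n\mapsto\ell(h_0^{-1}\cdot n))=\delta(\ell)$ for all $h_0\in H_0$ and $\ell\in X_N$, such that $\Delta(x)(m)=\delta(n\mapsto x(m\triangleleft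 n))$ for all $x\in X$ and $m\in M$. It is *pre-injective* if $x=x'$ for all $x,x'\in X$ such that $\{m\in M : x(m)\ne x'(m)\}$ is finite and $\Delta(x)=\Delta(x')$. **Theorem (Garden of Eden theorem).** Let $X$ be a non-empty strongly irreducible subshift of $Q^M$ of finite type, let $Y$ be a strongly irreducible subshift of $Q^M$ such that $\operatorname{ent}_{\mathcal F}(X)=\operatorname{ent}_{\mathcal F}(Y)$, and let $\Delta$ be a local map from $X$ to $Y$. Then $\Delta$ is surjective if and only if it is pre-injective. -/

import Mathlib

open Filter Topology
open scoped Pointwise NNReal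

noncomputable section

/-- A cell space: a left group set `(M, G, •)` together with a coordinate system, i.e. a
distinguished cell `m₀` and, for each cell `m`, a group element `g_{m₀,m}` with `g_{m₀,m} • m₀ = m`.
The last field makes the action transitive (see `CellSpace.isPretransitive`). -/
structure CellSpace (G M : Type*) [Group G] [MulAction G M] where
  /-- the origin `m₀` -/
  origin : M
  /-- the coordinates `g_{m₀,m}` -/
  coord : M → G
  coord_smul_origin : ∀ m, coord m • origin = m

namespace CellSpace

theorem isPretransitive {G M : Type*} [Group G] [MulAction G M] (R : CellSpace G M) :
    MulAction.IsPretransitive G M := by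
  refine ⟨fun x y => ⟨R.coord y * (R.coord x)⁻¹, ?_⟩⟩
  have hx : (R.coord x)⁻¹ • x = R.origin := by
    rw [inv_smul_eq_iff, R.coord_smul_origin]
  rw [mul_smul, hx, R.coord_smul_origin]

variable {G M : Type*} [Group G] [MulAction G M] (R : CellSpace G M)

/-- The stabiliser `G₀` of the origin. -/
abbrev stab : Subgroup G := MulAction.stabilizer G R.origin

/-- The right quotient set semi-action `m ◁ gG₀ = (g_{m₀,m} g g_{m₀,m}⁻¹) • m = g_{m₀,m} g • m₀` of
`G ⧸ G₀` on `M`. -/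
def semiAct (m : M) (q : G ⧸ R.stab) : M :=
  R.coord m • MulAction.ofQuotientStabilizer G R.origin q

theorem semiAct_mk (m : M) (g : G) :
    R.semiAct m (g : G ⧸ R.stab) = (R.coord m * g * (R.coord m)⁻¹) • m := by
  have hm : (R.coord m)⁻¹ • m = R.origin := by
    rw [inv_smul_eq_iff, R.coord_smul_origin]
  rw [mul_smul, hm, mul_smul]
  rfl

/-- The identification `m ↦ G_{m₀,m} = g_{m₀,m} G₀` of `M` with `G ⧸ G₀`. -/
def toQuotient (m : M) : G ⧸ R.stab := (R.coord m : G ⧸ R.stab)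

theorem semiAct_toQuotient (m n : M) : R.semiAct m (R.toQuotient n) = R.coord m • n := by
  rw [toQuotient, semiAct_mk, mul_smul, mul_smul]
  have hm : (R.coord m)⁻¹ • m = R.origin := by
    rw [inv_smul_eq_iff, R.coord_smul_origin]
  rw [hm, R.coord_smul_origin]

/-- Finitely additive probability measures on the power set of `M`. -/
def IsFinAddProbability (μ : Set M → ℝ≥0) : Prop :=
  μ Set.univ = 1 ∧ ∀ A B : Set M, Disjoint A B → μ (A ∪ B) = μ A + μ B

/-- Right amenability: there is a finitely additive probability measure on `M` that is
semi-invariant under the right semi-action. -/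
def IsRightAmenable : Prop :=
  ∃ μ : Set M → ℝ≥0, IsFinAddProbability μ ∧
    ∀ (q : G ⧸ R.stab) (A : Set M), Set.InjOn (fun m => R.semiAct m q) A →
      μ ((fun m => R.semiAct m q) '' A) = μ A

/-- `S⁻¹ = {g⁻¹G₀ | s ∈ S, g ∈ s}`. -/
def invSet (S : Set (G ⧸ R.stab)) : Set (G ⧸ R.stab) :=
  {t | ∃ s ∈ S, ∃ g : G, (g : G ⧸ R.stab) = s ∧ t = ((g⁻¹ : G) : G ⧸ R.stab)}

/-- Right generating sets: `G₀ · S ⊆ S` and each cell has the form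
`(((m₀ ◁ s₁) ◁ s₂) ⋯) ◁ s_k` with `s₁, …, s_k ∈ S ∪ S⁻¹`. -/
def IsRightGenerating (S : Set (G ⧸ R.stab)) : Prop :=
  (∀ g ∈ R.stab, ∀ s ∈ S, g • s ∈ S) ∧
    ∀ m : M, ∃ l : List (G ⧸ R.stab), (∀ s ∈ l, s ∈ S ∪ R.invSet S) ∧
      l.foldl R.semiAct R.origin = m

/-- Symmetric subsets of `G ⧸ G₀`: `S⁻¹ ⊆ S`. -/
def IsSymmetricSet (S : Set (G ⧸ R.stab)) : Prop := R.invSet S ⊆ S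

/-- The `S`-metric: the least length of a path from `m` to `m'` in the `S`-Cayley graph, whose edges
lead from `a` to `a ◁ s` for `s ∈ S`. A path is given by the list of its labels. -/
def cdist (S : Set (G ⧸ R.stab)) (m m' : M) : ℕ∞ :=
  ⨅ (l : List (G ⧸ R.stab)) (_ : (∀ s ∈ l, s ∈ S) ∧ l.foldl R.semiAct m = m'), (l.length : ℕ∞)

/-- The distance of two sets of cells (infinite if one of them is empty). -/
def setDist (S : Set (G ⧸ R.stab)) (A B : Set M) : ℕ∞ :=
  ⨅ a ∈ A, ⨅ b ∈ B, R.cdist S a b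

/-- The ball of radius `ρ` centred at `m`. -/
def ball (S : Set (G ⧸ R.stab)) (m : M) (ρ : ℕ) : Set M := {m' | R.cdist S m m' ≤ ρ}

/-- The `θ`-interior `A^{-θ}`. -/
def interior (S : Set (G ⧸ R.stab)) (θ : ℕ) (A : Set M) : Set M := {m ∈ A | R.ball S m θ ⊆ A}

/-- The `θ`-closure `A^{+θ}`. -/
def closure (S : Set (G ⧸ R.stab)) (θ : ℕ) (A : Set M) : Set M :=
  {m | (R.ball S m θ ∩ A).Nonempty}

/-- The `θ`-boundary `A^{+θ} \ A^{-θ}`. -/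
def boundary (S : Set (G ⧸ R.stab)) (θ : ℕ) (A : Set M) : Set M :=
  R.closure S θ A \ R.interior S θ A

/-- Right Følner nets: nets of non-empty finite sets of cells such that, for each `ρ`, the ratio
`|∂_ρ F_i| / |F_i|` tends to `0`. -/
def IsRightFolnerNet (S : Set (G ⧸ R.stab)) {I : Type*} [Preorder I] (F : I → Finset M) : Prop :=
  (∀ i, (F i).Nonempty) ∧
    ∀ ρ : ℕ, Tendsto (fun i => ((R.boundary S ρ (F i : Set M)).ncard : ℝ) / ((F i).card : ℝ))
      atTop (𝓝 0)

/-- `𝒦`-big subgroups: those that contain all coordinates. -/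
def IsBig (H : Subgroup G) : Prop := ∀ m, R.coord m ∈ H

end CellSpace

/-- A pattern: a map from a set of cells, its domain, to the set of states. -/
structure CellPattern (M Q : Type*) where
  /-- the domain -/
  dom : Set M
  /-- the states -/
  val : dom → Q

namespace CellPattern

variable {G M Q : Type*} [Group G] [MulAction G M]

/-- The restriction of a point of the full shift to `A`, as a pattern. -/
def ofPoint (c : M → Q) (A : Set M) : CellPattern M Q := ⟨A, fun a => c a⟩

/-- The left action of `G` on patterns: `g ▶ p` has domain `g • dom p` and maps `m` to
`p (g⁻¹ • m)`. -/
def shift (g : G) (p : CellPattern M Q) : CellPattern M Q :=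
  ⟨g • p.dom, fun m => p.val ⟨g⁻¹ • (m : M), Set.mem_smul_set_iff_inv_smul_mem.1 m.2⟩⟩

theorem shift_eq_ofPoint_iff (g : G) (p : CellPattern M Q) (c : M → Q) :
    p.shift g = ofPoint c (g • p.dom) ↔ ∀ a : p.dom, c (g • (a : M)) = p.val a := by
  simp only [shift, ofPoint, CellPattern.mk.injEq, heq_eq_eq, true_and, funext_iff]
  constructor
  · intro h a
    have h2 := h ⟨g • (a : M), Set.smul_mem_smul_set a.2⟩
    simp only [inv_smul_smul] at h2
    exact h2.symm
  · intro h m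
    have h2 := h ⟨g⁻¹ • (m : M), Set.mem_smul_set_iff_inv_smul_mem.1 m.2⟩
    simp only [smul_inv_smul] at h2
    exact h2.symm

end CellPattern

namespace CellSpace

variable {G M : Type*} [Group G] [MulAction G M] (R : CellSpace G M) (H : Subgroup G)
  (S : Set (G ⧸ R.stab)) {Q : Type*}

/-- The pattern `p` semi-occurs at `m` in the point `c`: there is an `h ∈ H` with `h • m₀ = m` and
`h ▶ p = c|_{h • dom p}`. -/
def SemiOccursAt (p : CellPattern M Q) (m : M) (c : M → Q) : Prop :=
  ∃ h ∈ H, h • R.origin = m ∧ p.shift h = CellPattern.ofPoint c (h • p.dom)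

/-- The pattern `p` semi-occurs in the point `c`. -/
def SemiOccurs (p : CellPattern M Q) (c : M → Q) : Prop := ∃ m, R.SemiOccursAt H p m c

/-- The pattern `p` is allowed in `X`. -/
def Allowed (X : Set (M → Q)) (p : CellPattern M Q) : Prop := ∃ x ∈ X, R.SemiOccurs H p x

/-- The set of points of the full shift in which no pattern of `𝔉` semi-occurs. -/
def generated (𝔉 : Set (CellPattern M Q)) : Set (M → Q) :=
  {c | ∀ f ∈ 𝔉, ¬ R.SemiOccurs H f c}

/-- Subshifts (shift spaces): sets generated by a set of forbidden blocks, i.e. of patterns with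
finite domains. -/
def IsSubshift (X : Set (M → Q)) : Prop :=
  ∃ 𝔉 : Set (CellPattern M Q), (∀ f ∈ 𝔉, f.dom.Finite) ∧ R.generated H 𝔉 = X

/-- Subshifts of finite type: sets generated by a finite set of forbidden blocks. -/
def IsSubshiftOfFiniteType (X : Set (M → Q)) : Prop :=
  ∃ 𝔉 : Set (CellPattern M Q), 𝔉.Finite ∧ (∀ f ∈ 𝔉, f.dom.Finite) ∧ R.generated H 𝔉 = X

/-- `κ`-strong irreducibility: any two finite allowed patterns whose domains have distance at least
`κ + 1` are embedded, at their own places, in a common point of `X`. -/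
def IsStronglyIrreducibleWith (κ : ℕ) (X : Set (M → Q)) : Prop :=
  ∀ p p' : CellPattern M Q, p.dom.Finite → p'.dom.Finite → R.Allowed H X p → R.Allowed H X p' →
    ((κ + 1 : ℕ) : ℕ∞) ≤ R.setDist S p.dom p'.dom →
      ∃ x ∈ X, CellPattern.ofPoint x p.dom = p ∧ CellPattern.ofPoint x p'.dom = p'

/-- Strong irreducibility. -/
def IsStronglyIrreducible (X : Set (M → Q)) : Prop :=
  ∃ κ : ℕ, R.IsStronglyIrreducibleWith H S κ X

/-- The set `X_A` of all restrictions to `A` of points of `X`. -/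
def patterns (X : Set (M → Q)) (A : Set M) : Set (A → Q) := A.domRestrict '' X

/-- The left action `(g₀, ℓ) ↦ (n ↦ ℓ (g₀⁻¹ • n))` of `G₀` on local configurations `ℓ : N → Q`. -/
def rotate {N : Set M} (hN : ∀ g ∈ R.stab, ∀ n ∈ N, g • n ∈ N) (g : R.stab) (ℓ : N → Q) : N → Q :=
  fun n => ℓ ⟨(g : G)⁻¹ • (n : M), hN _ (R.stab.inv_mem g.2) n n.2⟩

/-- `κ`-local maps from `X` to `Y`: there are a neighbourhood `N ⊆ ball(m₀, κ)` with `G₀ • N ⊆ N` and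
a local transition function `δ` on `X_N`, invariant under `H₀ = H ∩ G₀`, such that
`Δ(x)(m) = δ(n ↦ x(m ◁ n))`. The function `δ` is written as a function on all of `N → Q`; only its
values on `X_N` are constrained and, `X` being shift-invariant, used. -/
def IsLocalWith (κ : ℕ) {X Y : Set (M → Q)} (Δ : X → Y) : Prop :=
  ∃ (N : Set M) (hN : ∀ g ∈ R.stab, ∀ n ∈ N, g • n ∈ N) (δ : (N → Q) → Q),
    N ⊆ R.ball S R.origin κ ∧
    (∀ g : R.stab, (g : G) ∈ H → ∀ ℓ ∈ patterns X N, δ (R.rotate hN g ℓ) = δ ℓ) ∧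
    ∀ (x : X) (m : M),
      (Δ x : M → Q) m = δ (fun n => (x : M → Q) (R.semiAct m (R.toQuotient (n : M))))

/-- Local maps from `X` to `Y`. -/
def IsLocal {X Y : Set (M → Q)} (Δ : X → Y) : Prop := ∃ κ : ℕ, R.IsLocalWith H S κ Δ

/-- Pre-injectivity: points with finite difference and the same image are equal. -/
def IsPreInjective {X Y : Set (M → Q)} (Δ : X → Y) : Prop :=
  ∀ x x' : X, {m | (x : M → Q) m ≠ (x' : M → Q) m}.Finite → Δ x = Δ x' → x = x'

/-- The entropy `limsup_i log |X_{F_i}| / |F_i|` of a non-empty set `X` of points with respect to the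
net `F`. For a finite set of states and non-empty `F_i` the quotients lie between `0` and `log |Q|`,
so that the limit superior is a genuine one. -/
def entropy {I : Type*} [Preorder I] (F : I → Finset M) (X : Set (M → Q)) : ℝ :=
  limsup (fun i => Real.log ((patterns X (F i : Set M)).ncard : ℝ) / ((F i).card : ℝ)) atTop

end CellSpace

end

/-! ### Balls of the `S`-metric and their symmetries. -/

namespace CellSpace

variable {G M : Type*} [Group G] [MulAction G M] (R : CellSpace G M) {S : Set (G ⧸ R.stab)}

/-! Both implications compare entropies; the engine is `IsStronglyIrreducibleWith.entropy_lt`. If a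
subset of a strongly irreducible space avoids an allowed pattern at every cell of a separated,
relatively dense set `T`, its entropy is strictly smaller: forbidding one more pattern multiplies
the number of patterns on a finite set by at most `K / (K + 1)`, with `K` independent of the cell,
and a Følner net meets `T` with positive density.

Surjective implies pre-injective: suppose `x ≠ x'` differ on a finite set and have the same image.
Replace all copies of `x` about the cells of `T` by copies of `x'`. Finite type keeps the result in
`X`, and its image does not change. So the swapped points still map onto `Y`, although they avoid
`x` along `T` and hence have smaller entropy than `X`. Local maps do not raise entropy, a
contradiction.

Pre-injective implies surjective: by compactness, a point outside the image has a finite pattern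
that no image point shows; by equivariance it is missing at every cell, so the image has smaller
entropy than `Y`, hence than `X`. Some `F i` then carries more patterns of `X` than there are
patterns of the image on a neighbourhood of `F i`. Extending the former by one fixed point far away,
the pigeonhole principle contradicts pre-injectivity. -/

theorem mem_ball_iff {m m' : M} {ρ : ℕ} :
    m' ∈ R.ball S m ρ ↔
      ∃ l : List (G ⧸ R.stab), (∀ s ∈ l, s ∈ S) ∧ l.length ≤ ρ ∧ l.foldl R.semiAct m = m' := by
  constructor
  · intro h
    have h1 : R.cdist S m m' < ((ρ + 1 : ℕ) : ℕ∞) :=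
      lt_of_le_of_lt h (by exact_mod_cast Nat.lt_succ_self ρ)
    simp only [cdist, iInf_lt_iff] at h1
    obtain ⟨l, ⟨hl, hm⟩, hlt⟩ := h1
    exact ⟨l, hl, Nat.lt_succ_iff.1 (by exact_mod_cast hlt), hm⟩
  · rintro ⟨l, hl, hlen, hm⟩
    have h : R.cdist S m m' ≤ (l.length : ℕ∞) := iInf₂_le l ⟨hl, hm⟩
    exact h.trans (by exact_mod_cast hlen)

theorem mem_ball_self (m : M) (ρ : ℕ) : m ∈ R.ball S m ρ :=
  R.mem_ball_iff.2 ⟨[], by simp, by simp, rfl⟩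

theorem mem_ball_trans {a b c : M} {ρ θ : ℕ} (hab : b ∈ R.ball S a ρ) (hbc : c ∈ R.ball S b θ) :
    c ∈ R.ball S a (ρ + θ) := by
  obtain ⟨l, hl, hlen, rfl⟩ := R.mem_ball_iff.1 hab
  obtain ⟨l', hl', hlen', rfl⟩ := R.mem_ball_iff.1 hbc
  refine R.mem_ball_iff.2 ⟨l ++ l', ?_, ?_, by simp⟩
  · intro s hs
    exact (List.mem_append.1 hs).elim (hl s) (hl' s)
  · simpa using Nat.add_le_add hlen hlen'

theorem ball_subset_ball (m : M) {ρ θ : ℕ} (h : ρ ≤ θ) : R.ball S m ρ ⊆ R.ball S m θ :=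
  fun _ hm => le_trans (show R.cdist S _ _ ≤ _ from hm) (by exact_mod_cast h)

/-- The elements `g * coord m` and `coord (g • m)` both carry the origin to `g • m`, so they differ
by some `k` in the stabiliser. As `S` is stable under `G₀`, left translations preserve edges, hence
balls. -/
theorem exists_stab_smul_semiAct (g : G) (m : M) :
    ∃ k ∈ R.stab, ∀ q : G ⧸ R.stab, g • R.semiAct m q = R.semiAct (g • m) (k • q) := by
  refine ⟨(R.coord (g • m))⁻¹ * g * R.coord m, ?_, fun q => ?_⟩
  · rw [MulAction.mem_stabilizer_iff, mul_smul, mul_smul, R.coord_smul_origin, inv_smul_eq_iff,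
      R.coord_smul_origin]
  · induction q using QuotientGroup.induction_on with
    | H a =>
      simp only [semiAct, MulAction.ofQuotientStabilizer_smul, mul_smul, smul_inv_smul]

theorem smul_mem_ball (hgen : R.IsRightGenerating S) (g : G) {m m' : M} {ρ : ℕ}
    (h : m' ∈ R.ball S m ρ) : g • m' ∈ R.ball S (g • m) ρ := by
  obtain ⟨l, hl, hlen, rfl⟩ := R.mem_ball_iff.1 h
  clear h
  induction l generalizing m ρ with
  | nil => exact R.mem_ball_self _ _
  | cons s l ih =>
    obtain ⟨k, hk, hs⟩ := R.exists_stab_smul_semiAct g m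
    have h1 : g • R.semiAct m s ∈ R.ball S (g • m) 1 :=
      R.mem_ball_iff.2 ⟨[k • s], by simpa using hgen.1 k hk s (hl s (by simp)), by simp,
        by simp [hs]⟩
    have h2 := ih (m := R.semiAct m s) (ρ := l.length) (fun t ht => hl t (by simp [ht])) le_rfl
    refine R.ball_subset_ball _ ?_ (R.mem_ball_trans h1 h2)
    simpa [add_comm] using hlen

theorem mem_ball_of_smul_mem_ball (hgen : R.IsRightGenerating S) (g : G) {m m' : M} {ρ : ℕ}
    (h : g • m' ∈ R.ball S (g • m) ρ) : m' ∈ R.ball S m ρ := by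
  simpa using R.smul_mem_ball hgen g⁻¹ h

/-- The edge labelled `aG₀` is reversed by `a⁻¹G₀` only after correction by the stabiliser element
that relates the coordinates of its two ends; `G₀ · S ⊆ S` allows that. -/
theorem semiAct_mem_ball_symm (hgen : R.IsRightGenerating S) (hsymm : R.IsSymmetricSet S) (m : M)
    {s : G ⧸ R.stab} (hs : s ∈ S) : m ∈ R.ball S (R.semiAct m s) 1 := by
  induction s using QuotientGroup.induction_on with
  | H a =>
    have h1 : ((a⁻¹ : G) : G ⧸ R.stab) ∈ S := hsymm ⟨_, hs, a, rfl, rfl⟩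
    set m' := R.semiAct m (a : G ⧸ R.stab) with hm'
    have hm : m' = R.coord m • a • R.origin := rfl
    have hk : (R.coord m')⁻¹ * (R.coord m * a) ∈ R.stab := by
      rw [MulAction.mem_stabilizer_iff, mul_smul, mul_smul, inv_smul_eq_iff, R.coord_smul_origin,
        hm]
    refine R.mem_ball_iff.2 ⟨[((R.coord m')⁻¹ * (R.coord m * a)) • ((a⁻¹ : G) : G ⧸ R.stab)], ?_,
      by simp, ?_⟩
    · simpa using hgen.1 _ hk _ h1
    · simp [semiAct, mul_smul, MulAction.ofQuotientStabilizer_mk, R.coord_smul_origin]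

theorem mem_ball_symm (hgen : R.IsRightGenerating S) (hsymm : R.IsSymmetricSet S) {m m' : M}
    {ρ : ℕ} (h : m' ∈ R.ball S m ρ) : m ∈ R.ball S m' ρ := by
  obtain ⟨l, hl, hlen, rfl⟩ := R.mem_ball_iff.1 h
  clear h
  induction l generalizing m ρ with
  | nil => exact R.mem_ball_self _ _
  | cons s l ih =>
    have h1 := R.semiAct_mem_ball_symm hgen hsymm m (hl s (by simp))
    have h2 := ih (m := R.semiAct m s) (ρ := l.length) (fun t ht => hl t (by simp [ht])) le_rfl
    exact R.ball_subset_ball _ (by simpa using hlen) (R.mem_ball_trans h2 h1)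

theorem finite_ball (hfin : S.Finite) (m : M) (ρ : ℕ) : (R.ball S m ρ).Finite := by
  have : Finite S := hfin
  refine ((List.finite_length_le S ρ).image
    fun l => (l.map Subtype.val).foldl R.semiAct m).subset ?_
  intro m' h
  obtain ⟨l, hl, hlen, rfl⟩ := R.mem_ball_iff.1 h
  lift l to List S using hl
  exact ⟨l, by simpa using hlen, rfl⟩

theorem exists_mem_ball (hgen : R.IsRightGenerating S) (hsymm : R.IsSymmetricSet S) (m : M) :
    ∃ ρ, m ∈ R.ball S R.origin ρ := by
  obtain ⟨l, hl, hm⟩ := hgen.2 m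
  exact ⟨l.length, R.mem_ball_iff.2 ⟨l, fun s hs => (hl s hs).elim id (fun h => hsymm h), le_rfl,
    hm⟩⟩

theorem exists_subset_ball (hgen : R.IsRightGenerating S) (hsymm : R.IsSymmetricSet S) {A : Set M}
    (hA : A.Finite) : ∃ ρ, A ⊆ R.ball S R.origin ρ := by
  choose r hr using R.exists_mem_ball hgen hsymm
  obtain ⟨ρ, hρ⟩ := (hA.image r).bddAbove
  exact ⟨ρ, fun a ha => R.ball_subset_ball _ (hρ ⟨a, ha, rfl⟩) (hr a)⟩

theorem smul_ball (hgen : R.IsRightGenerating S) (g : G) (m : M) (ρ : ℕ) :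
    g • R.ball S m ρ = R.ball S (g • m) ρ := by
  ext m'
  rw [Set.mem_smul_set_iff_inv_smul_mem]
  constructor
  · intro h
    simpa using R.smul_mem_ball hgen g h
  · intro h
    exact R.mem_ball_of_smul_mem_ball hgen g (by simpa using h)

theorem ncard_ball (hgen : R.IsRightGenerating S) (m : M) (ρ : ℕ) :
    (R.ball S m ρ).ncard = (R.ball S R.origin ρ).ncard := by
  rw [← R.coord_smul_origin m, ← R.smul_ball hgen, Set.ncard_smul_set]

theorem coord_inv_smul_mem_ball_iff (hgen : R.IsRightGenerating S) {t m : M} {ρ : ℕ} :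
    (R.coord t)⁻¹ • m ∈ R.ball S R.origin ρ ↔ m ∈ R.ball S t ρ := by
  conv_rhs => rw [← R.coord_smul_origin t, ← R.smul_ball hgen]
  exact Set.mem_smul_set_iff_inv_smul_mem.symm

end CellSpace

/-! ### Subshifts, gluing, and locality of maps. -/

namespace CellSpace

variable {G M Q : Type*} [Group G] [MulAction G M] (R : CellSpace G M) {S : Set (G ⧸ R.stab)}
  {H : Subgroup G} {X Y : Set (M → Q)}

theorem semiOccurs_iff (p : CellPattern M Q) (c : M → Q) :
    R.SemiOccurs H p c ↔ ∃ h ∈ H, ∀ a : p.dom, c (h • (a : M)) = p.val a := by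
  simp only [SemiOccurs, SemiOccursAt, CellPattern.shift_eq_ofPoint_iff]
  constructor
  · rintro ⟨_, h, hh, -, hp⟩
    exact ⟨h, hh, hp⟩
  · rintro ⟨h, hh, hp⟩
    exact ⟨_, h, hh, rfl, hp⟩

variable {R}

theorem IsSubshift.comp_smul_mem (hX : R.IsSubshift H X) {h : G} (hh : h ∈ H) {x : M → Q}
    (hx : x ∈ X) : (fun m => x (h • m)) ∈ X := by
  obtain ⟨𝔉, -, rfl⟩ := hX
  intro f hf hocc
  obtain ⟨k, hk, hp⟩ := (R.semiOccurs_iff f _).1 hocc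
  exact hx f hf ((R.semiOccurs_iff f _).2 ⟨h * k, H.mul_mem hh hk, by simpa [mul_smul] using hp⟩)

theorem IsSubshiftOfFiniteType.isSubshift (hX : R.IsSubshiftOfFiniteType H X) :
    R.IsSubshift H X :=
  let ⟨𝔉, _, h, h'⟩ := hX
  ⟨𝔉, h, h'⟩

theorem IsSubshift.isClosed [TopologicalSpace Q] [DiscreteTopology Q] (hX : R.IsSubshift H X) :
    IsClosed X := by
  obtain ⟨𝔉, hfin, rfl⟩ := hX
  have : R.generated H 𝔉 =
      ⋂ f ∈ 𝔉, ⋂ h ∈ H, (⋂ a : f.dom, {c : M → Q | c (h • (a : M)) = f.val a})ᶜ := by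
    ext c
    simp [generated, semiOccurs_iff]
  rw [this]
  refine isClosed_biInter fun f hf => isClosed_biInter fun h _ => ?_
  have : Finite f.dom := hfin f hf
  refine (isOpen_iInter_of_finite fun a => ?_).isClosed_compl
  exact (isOpen_discrete ({f.val a} : Set Q)).preimage
    (continuous_apply (A := fun _ : M => Q) (h • (a : M)))

/-- Subshifts of finite type have bounded memory: membership is a local condition. -/
theorem IsSubshiftOfFiniteType.exists_memory (hgen : R.IsRightGenerating S)
    (hsymm : R.IsSymmetricSet S) (hX : R.IsSubshiftOfFiniteType H X) :
    ∃ ρ : ℕ, ∀ c : M → Q, (∀ m, ∃ y ∈ X, Set.EqOn c y (R.ball S m ρ)) → c ∈ X := by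
  obtain ⟨𝔉, hfin, hdom, rfl⟩ := hX
  obtain ⟨ρ, hρ⟩ := R.exists_subset_ball hgen hsymm (hfin.biUnion hdom)
  refine ⟨ρ, fun c hc f hf hocc => ?_⟩
  obtain ⟨h, hh, hp⟩ := (R.semiOccurs_iff f c).1 hocc
  -- All forbidden domains lie in the `ρ`-ball about the origin, so this occurrence lies in the
  -- `ρ`-ball about `h • R.origin`, where `c` is a point of `X`.
  obtain ⟨y, hy, hcy⟩ := hc (h • R.origin)
  refine hy f hf ((R.semiOccurs_iff f y).2 ⟨h, hh, fun a => ?_⟩)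
  rw [← hp a, hcy]
  exact R.smul_mem_ball hgen h (hρ (Set.mem_biUnion hf a.2))

theorem IsStronglyIrreducibleWith.exists_eqOn {κ : ℕ} (hX : R.IsStronglyIrreducibleWith H S κ X)
    {x x' : M → Q} (hx : x ∈ X) (hx' : x' ∈ X) {A A' : Set M} (hA : A.Finite) (hA' : A'.Finite)
    (hd : ∀ a ∈ A, ∀ b ∈ A', b ∉ R.ball S a κ) : ∃ z ∈ X, Set.EqOn z x A ∧ Set.EqOn z x' A' := by
  have allowed : ∀ y ∈ X, ∀ B : Set M, R.Allowed H X (CellPattern.ofPoint y B) := fun y hy B =>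
    ⟨y, hy, (R.semiOccurs_iff _ _).2 ⟨1, H.one_mem, fun a => by simp [CellPattern.ofPoint]⟩⟩
  obtain ⟨z, hz, h1, h2⟩ := hX (.ofPoint x A) (.ofPoint x' A') hA hA' (allowed x hx A)
    (allowed x' hx' A') (by
      refine le_iInf₂ fun a ha => le_iInf₂ fun b hb => ?_
      have := hd a ha b hb
      rw [ball, Set.mem_ofPred_eq, not_le] at this
      simpa using Order.add_one_le_of_lt this)
  simp only [CellPattern.ofPoint, CellPattern.mk.injEq, heq_eq_eq, true_and, funext_iff] at h1 h2
  exact ⟨z, hz, fun a ha => h1 ⟨a, ha⟩, fun a ha => h2 ⟨a, ha⟩⟩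

/-- Gluing along an infinite set, by compactness. -/
theorem IsStronglyIrreducibleWith.exists_eqOn_of_finite [Finite Q] {κ : ℕ}
    (hsub : R.IsSubshift H X) (hX : R.IsStronglyIrreducibleWith H S κ X)
    {x x' : M → Q} (hx : x ∈ X) (hx' : x' ∈ X) {A A' : Set M} (hA : A.Finite)
    (hd : ∀ a ∈ A, ∀ b ∈ A', b ∉ R.ball S a κ) : ∃ z ∈ X, Set.EqOn z x A ∧ Set.EqOn z x' A' := by
  let _ : TopologicalSpace Q := ⊥
  have : DiscreteTopology Q := ⟨rfl⟩
  have cyl : ∀ (y : M → Q) (m : M), IsClosed {z : M → Q | z m = y m} := fun y m =>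
    isClosed_eq (continuous_apply m) continuous_const
  have hK : IsCompact (X ∩ ⋂ a ∈ A, {z : M → Q | z a = x a}) :=
    (hsub.isClosed.inter (isClosed_biInter fun a _ => cyl x a)).isCompact
  obtain ⟨z, ⟨hzX, hzA⟩, hzA'⟩ := hK.inter_iInter_nonempty (fun b : A' => {z : M → Q | z b = x' b})
    (fun b => cyl x' b) (fun u => by
      obtain ⟨z, hz, h1, h2⟩ := hX.exists_eqOn hx hx' hA (u.finite_toSet.image Subtype.val)
        (by rintro a ha _ ⟨b, -, rfl⟩; exact hd a ha b b.2)
      exact ⟨z, ⟨hz, Set.mem_iInter₂.2 h1⟩, Set.mem_iInter₂.2 fun b hb => h2 ⟨b, hb, rfl⟩⟩)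
  exact ⟨z, hzX, fun a ha => Set.mem_iInter₂.1 hzA a ha, fun b hb => Set.mem_iInter.1 hzA' ⟨b, hb⟩⟩

theorem IsLocalWith.apply_eq_of_eqOn (hgen : R.IsRightGenerating S) {κ : ℕ} {Δ : X → Y}
    (hΔ : R.IsLocalWith H S κ Δ) {x x' : X} {m : M}
    (h : Set.EqOn (x : M → Q) x' (R.ball S m κ)) : (Δ x : M → Q) m = (Δ x' : M → Q) m := by
  obtain ⟨N, hN, δ, hNκ, -, hδ⟩ := hΔ
  rw [hδ, hδ]
  congr 1
  ext n
  rw [R.semiAct_toQuotient]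
  apply h
  simpa [R.coord_smul_origin] using R.smul_mem_ball hgen (R.coord m) (hNκ n.2)

/-- Equivariance under `H`: the neighbourhoods read at `h • m` and, through `h`, at `m` differ by a
rotation in `H ∩ G₀`, which `δ` ignores. -/
theorem IsLocalWith.apply_smul (hH : R.IsBig H) (hX : R.IsSubshift H X) {κ : ℕ} {Δ : X → Y}
    (hΔ : R.IsLocalWith H S κ Δ) {h : G} (hh : h ∈ H) (x : X) (m : M) :
    (Δ ⟨fun m => (x : M → Q) (h • m), hX.comp_smul_mem hh x.2⟩ : M → Q) m
      = (Δ x : M → Q) (h • m) := by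
  obtain ⟨N, hN, δ, -, hrot, hδ⟩ := hΔ
  have hk : (R.coord (h • m))⁻¹ * (h * R.coord m) ∈ R.stab := by
    rw [MulAction.mem_stabilizer_iff, mul_smul, mul_smul, inv_smul_eq_iff, R.coord_smul_origin,
      R.coord_smul_origin]
  rw [hδ, hδ, ← hrot ⟨_, hk⟩ (H.mul_mem (H.inv_mem (hH _)) (H.mul_mem hh (hH m)))]
  · congr 1
    ext n
    simp [rotate, R.semiAct_toQuotient, mul_smul]
  · refine ⟨_, hX.comp_smul_mem (H.mul_mem hh (hH m)) x.2, ?_⟩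
    ext n
    simp [R.semiAct_toQuotient, mul_smul]

/-- The image of a local map is closed: a point that agrees with points of the image on each finite
set belongs to the image. -/
theorem IsLocalWith.mem_range_of_forall_finite [Finite Q] (hgen : R.IsRightGenerating S)
    (hfin : S.Finite) (hX : R.IsSubshift H X) {κ : ℕ} {Δ : X → Y} (hΔ : R.IsLocalWith H S κ Δ)
    (y : Y) (h : ∀ A : Set M, A.Finite → ∃ x, Set.EqOn (Δ x : M → Q) y A) : ∃ x, Δ x = y := by
  let _ : TopologicalSpace Q := ⊥
  have : DiscreteTopology Q := ⟨rfl⟩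
  have : CompactSpace X := isCompact_iff_compactSpace.1 hX.isClosed.isCompact
  -- Each value of `Δ x` depends on finitely many states of `x`; compactness of `X` then turns
  -- agreement on finite sets into agreement everywhere.
  have hcont : ∀ m, Continuous fun x : X => (Δ x : M → Q) m := by
    intro m
    refine (IsLocallyConstant.iff_exists_open _).2 (fun x => ?_) |>.continuous
    refine ⟨⋂ n ∈ R.ball S m κ, {x' : X | (x' : M → Q) n = (x : M → Q) n},
      (R.finite_ball hfin m κ).isOpen_biInter fun n _ => ?_, by simp, fun x' hx' => ?_⟩
    · exact (isOpen_discrete ({(x : M → Q) n} : Set Q)).preimage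
        ((continuous_apply (A := fun _ : M => Q) n).comp continuous_subtype_val)
    · exact hΔ.apply_eq_of_eqOn hgen fun n hn => Set.mem_iInter₂.1 hx' n hn
  obtain ⟨x, -, hx⟩ := (isCompact_univ (X := X)).inter_iInter_nonempty
    (fun m => {x : X | (Δ x : M → Q) m = (y : M → Q) m})
    (fun m => isClosed_eq (hcont m) continuous_const) (fun u => by
      obtain ⟨x, hx⟩ := h u u.finite_toSet
      exact ⟨x, trivial, Set.mem_iInter₂.2 fun m hm => hx hm⟩)
  exact ⟨x, Subtype.ext (funext fun m => Set.mem_iInter.1 hx m)⟩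

end CellSpace

/-! ### Counting patterns on finite sets. -/

theorem Set.ncard_image_le_of_factor {α β γ : Type*} {s : Set α} {f : α → β} {g : α → γ}
    (hg : (g '' s).Finite) (h : ∀ x ∈ s, ∀ y ∈ s, g x = g y → f x = f y) :
    (f '' s).ncard ≤ (g '' s).ncard := by
  obtain rfl | ⟨x₀, -⟩ := s.eq_empty_or_nonempty
  · simp
  have : Nonempty α := ⟨x₀⟩
  choose! k hks hkf using fun b (hb : b ∈ f '' s) => hb
  refine Set.ncard_le_ncard_of_injOn (fun b => g (k b)) (fun b hb => ⟨_, hks b hb, rfl⟩) ?_ hg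
  intro b hb b' hb' hbb
  rw [← hkf b hb, ← hkf b' hb']
  exact h _ (hks b hb) _ (hks b' hb') hbb

namespace CellSpace

variable {M Q : Type*}

variable {G : Type*} [Group G] [MulAction G M] {R : CellSpace G M} {S : Set (G ⧸ R.stab)}
  {H : Subgroup G}

/-- Maximal `r`-separated sets of cells: their balls of radius `r` cover. -/
theorem exists_separated_cover (hgen : R.IsRightGenerating S) (hsymm : R.IsSymmetricSet S) (r : ℕ) :
    ∃ T : Set M, (∀ t ∈ T, ∀ t' ∈ T, t ≠ t' → t' ∉ R.ball S t r) ∧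
      ∀ m, ∃ t ∈ T, m ∈ R.ball S t r := by
  obtain ⟨T, hT⟩ := zorn_subset {T : Set M | T.Pairwise fun t t' => t' ∉ R.ball S t r}
    (fun c hc hchain => ⟨⋃₀ c, (Set.pairwise_sUnion hchain.directedOn).2 hc,
      fun _ => Set.subset_sUnion_of_mem⟩)
  refine ⟨T, fun t ht t' ht' hne => hT.prop ht ht' hne, fun m => ?_⟩
  by_contra! hm
  have hmT : m ∈ T := by
    refine hT.le_of_ge (y := insert m T) ?_ (Set.subset_insert _ _) (Set.mem_insert _ _)
    refine hT.prop.insert fun t ht _ => ⟨fun h => hm t ht ?_, hm t ht⟩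
    exact R.mem_ball_symm hgen hsymm h
  exact hm m hmT (R.mem_ball_self m r)

theorem domRestrict_eq_iff {x y : M → Q} {A : Set M} :
    A.domRestrict x = A.domRestrict y ↔ Set.EqOn x y A :=
  Set.domRestrict_eq_domRestrict_iff

variable [Finite Q]

theorem finite_patterns (X : Set (M → Q)) {A : Set M} (hA : A.Finite) : (patterns X A).Finite :=
  have : Finite A := hA
  Set.toFinite _

theorem ncard_patterns_le_pow (X : Set (M → Q)) {A : Set M} (hA : A.Finite) :
    (patterns X A).ncard ≤ Nat.card Q ^ A.ncard := by
  have : Finite A := hA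
  refine (Set.ncard_le_ncard (Set.subset_univ _)).trans_eq ?_
  rw [Set.ncard_univ, Nat.card_fun, Nat.card_coe_set_eq]

theorem ncard_patterns_pos {X : Set (M → Q)} (hX : X.Nonempty) {A : Set M} (hA : A.Finite) :
    0 < (patterns X A).ncard :=
  (Set.ncard_pos (finite_patterns X hA)).2 (hX.image _)

theorem ncard_patterns_mono {X X' : Set (M → Q)} (h : X ⊆ X') {A : Set M} (hA : A.Finite) :
    (patterns X A).ncard ≤ (patterns X' A).ncard :=
  Set.ncard_le_ncard (Set.image_mono h) (finite_patterns X' hA)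

theorem ncard_patterns_le_of_subset (X : Set (M → Q)) {A B : Set M} (h : A ⊆ B) (hB : B.Finite) :
    (patterns X A).ncard ≤ (patterns X B).ncard :=
  Set.ncard_image_le_of_factor (finite_patterns X hB) fun _ _ _ _ hxy =>
    domRestrict_eq_iff.2 ((domRestrict_eq_iff.1 hxy).mono h)

theorem ncard_patterns_le_mul (X : Set (M → Q)) {A B C : Set M} (h : A ⊆ B ∪ C) (hB : B.Finite)
    (hC : C.Finite) :
    (patterns X A).ncard ≤ (patterns X B).ncard * Nat.card Q ^ C.ncard := by
  have hsub : (fun x => (B.domRestrict x, C.domRestrict x)) '' X ⊆ patterns X B ×ˢ patterns X C := by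
    rintro _ ⟨x, hx, rfl⟩
    exact ⟨⟨x, hx, rfl⟩, ⟨x, hx, rfl⟩⟩
  have hfin := (finite_patterns X hB).prod (finite_patterns X hC)
  calc (patterns X A).ncard
      ≤ ((fun x => (B.domRestrict x, C.domRestrict x)) '' X).ncard := by
        refine Set.ncard_image_le_of_factor (hfin.subset hsub) fun x _ y _ hxy => ?_
        simp only [Prod.mk.injEq, domRestrict_eq_iff] at hxy
        exact domRestrict_eq_iff.2 ((hxy.1.union hxy.2).mono h)
    _ ≤ (patterns X B ×ˢ patterns X C).ncard := Set.ncard_le_ncard hsub hfin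
    _ = (patterns X B).ncard * (patterns X C).ncard := Set.ncard_prod
    _ ≤ _ := Nat.mul_le_mul_left _ (ncard_patterns_le_pow X hC)

/-- If each point of `X` agrees outside of `C` with a point of `W`, then `W` has at least a fixed
fraction of the patterns of `X`. -/
theorem ncard_patterns_le_of_replace {X W : Set (M → Q)} {A C : Set M} (hA : A.Finite)
    (hC : C.Finite) (h : ∀ x ∈ X, ∃ w ∈ W, Set.EqOn w x (A \ C)) :
    (patterns X A).ncard ≤ (patterns W A).ncard * Nat.card Q ^ C.ncard := by
  have hAC : (A \ C).Finite := hA.sdiff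
  refine (ncard_patterns_le_mul X (B := A \ C) (C := C) (by simp) hAC hC).trans ?_
  gcongr
  refine le_trans ?_ (ncard_patterns_le_of_subset W (Set.sdiff_subset (t := C)) hA)
  refine Set.ncard_le_ncard ?_ (finite_patterns W hAC)
  rintro _ ⟨x, hx, rfl⟩
  obtain ⟨w, hw, hwx⟩ := h x hx
  exact ⟨w, hw, domRestrict_eq_iff.2 hwx⟩

variable {X : Set (M → Q)}

/-- Induction on `T`. Given a point avoiding the patterns at `T` and at a new cell `t`, the pattern
at `t` can be planted by changing, within `A`, only the `(θ + κ)`-ball about `t`. This map on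
patterns is at most `K`-to-one, and its values are not avoiding at `t`, whence the factor `K / (K +
1)`. -/
theorem IsStronglyIrreducibleWith.ncard_patterns_avoiding_le (hgen : R.IsRightGenerating S)
    (hsymm : R.IsSymmetricSet S) (hfin : S.Finite) {κ : ℕ}
    (hX : R.IsStronglyIrreducibleWith H S κ X) (θ : ℕ) (p : M → M → Q) {A : Set M}
    (hA : A.Finite) (T : Finset M) (hp : ∀ t ∈ T, p t ∈ X)
    (hsep : ∀ t ∈ T, ∀ t' ∈ T, t ≠ t' → t' ∉ R.ball S t (2 * θ + κ))
    (hTA : ∀ t ∈ T, R.ball S t (θ + κ) ⊆ A) :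
    (Nat.card Q ^ (R.ball S R.origin (θ + κ)).ncard + 1) ^ T.card *
        (patterns {x ∈ X | ∀ t ∈ T, ¬ Set.EqOn x (p t) (R.ball S t θ)} A).ncard ≤
      (Nat.card Q ^ (R.ball S R.origin (θ + κ)).ncard) ^ T.card * (patterns X A).ncard := by
  classical
  set K := Nat.card Q ^ (R.ball S R.origin (θ + κ)).ncard with hK
  induction T using Finset.induction_on with
  | empty => simp
  | insert t T ht ih =>
    have ih := ih (fun t' h => hp t' (by simp [h]))
      (fun a ha b hb => hsep a (by simp [ha]) b (by simp [hb]))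
      (fun t' h => hTA t' (by simp [h]))
    set X₀ := {x ∈ X | ∀ t ∈ T, ¬ Set.EqOn x (p t) (R.ball S t θ)} with hX₀
    set X₁ := {x ∈ X | ∀ t' ∈ insert t T, ¬ Set.EqOn x (p t') (R.ball S t' θ)} with hX₁
    set W := {x ∈ X₀ | Set.EqOn x (p t) (R.ball S t θ)} with hW
    have h10 : X₁ ⊆ X₀ := fun x hx => ⟨hx.1, fun t' h => hx.2 t' (by simp [h])⟩
    have htA : R.ball S t θ ⊆ A :=
      (R.ball_subset_ball t (Nat.le_add_right _ _)).trans (hTA t (by simp))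
    have hcount : (patterns X₁ A).ncard ≤ (patterns W A).ncard * K := by
      rw [hK, ← R.ncard_ball hgen t]
      refine ncard_patterns_le_of_replace hA (R.finite_ball hfin _ _) fun x hx => ?_
      obtain ⟨w, hw, hwx, hwp⟩ := hX.exists_eqOn hx.1 (hp t (by simp))
        (A := A \ R.ball S t (θ + κ)) (A' := R.ball S t θ) hA.sdiff (R.finite_ball hfin _ _)
        (fun a ha b hb hba => ha.2 (R.mem_ball_trans hb (R.mem_ball_symm hgen hsymm hba)))
      refine ⟨w, ⟨⟨hw, fun t' h hwt => hx.2 t' (by simp [h]) fun m hm => ?_⟩, hwp⟩, hwx⟩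
      rw [← hwt hm]
      refine (hwx ⟨hTA t' (by simp [h]) (R.ball_subset_ball _ (Nat.le_add_right _ _) hm),
        fun hm' => ?_⟩).symm
      -- Separation by `2 * θ + κ` keeps the `θ`-ball about `t'` off the altered `(θ + κ)`-ball
      -- about `t`, so planting creates no forbidden pattern at `t'`.
      refine hsep t' (by simp [h]) t (by simp) (fun e => ht (e ▸ h)) ?_
      have := R.mem_ball_trans hm (R.mem_ball_symm hgen hsymm hm')
      rwa [← add_assoc, ← two_mul] at this
    have hdisj : (patterns X₁ A).ncard + (patterns W A).ncard ≤ (patterns X₀ A).ncard := by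
      rw [← Set.ncard_union_eq ?_ (finite_patterns _ hA) (finite_patterns _ hA)]
      · refine Set.ncard_le_ncard (Set.union_subset (Set.image_mono h10)
          (Set.image_mono fun x hx => hx.1)) (finite_patterns _ hA)
      · rw [Set.disjoint_left]
        rintro _ ⟨x, hx, rfl⟩ ⟨w, hw, hwx⟩
        exact hx.2 t (by simp)
          (((domRestrict_eq_iff.1 hwx).symm.mono htA).trans hw.2)
    have hstep : (K + 1) * (patterns X₁ A).ncard ≤ K * (patterns X₀ A).ncard := by
      nlinarith
    rw [Finset.card_insert_of_notMem ht, pow_succ, pow_succ]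
    calc (K + 1) ^ T.card * (K + 1) * (patterns X₁ A).ncard
      _ = (K + 1) ^ T.card * ((K + 1) * (patterns X₁ A).ncard) := by ring
      _ ≤ (K + 1) ^ T.card * (K * (patterns X₀ A).ncard) := Nat.mul_le_mul_left _ hstep
      _ = K * ((K + 1) ^ T.card * (patterns X₀ A).ncard) := by ring
      _ ≤ K * (K ^ T.card * (patterns X A).ncard) := Nat.mul_le_mul_left _ ih
      _ = _ := by ring

end CellSpace

/-! ### Entropy along Følner nets. -/

theorem Filter.limsup_le_limsup_add {ι : Type*} {l : Filter ι} [l.NeBot] {u v w : ι → ℝ} {c : ℝ}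
    (hu : IsBoundedUnder (· ≥ ·) l u) (hv : IsBoundedUnder (· ≤ ·) l v) (hw : Tendsto w l (𝓝 c))
    (h : ∀ᶠ i in l, u i ≤ v i + w i) : limsup u l ≤ limsup v l + c := by
  refine le_of_forall_pos_le_add fun ε hε => ?_
  refine limsup_le_of_le hu.isCoboundedUnder_le ?_
  filter_upwards [h, eventually_lt_of_limsup_lt (lt_add_of_pos_right (limsup v l) (half_pos hε)) hv,
    hw.eventually (gt_mem_nhds (lt_add_of_pos_right c (half_pos hε)))] with i h1 h2 h3
  linarith

namespace CellSpace

variable {G M Q I : Type*} [Group G] [MulAction G M] {R : CellSpace G M} {S : Set (G ⧸ R.stab)}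
  {H : Subgroup G} {X Z : Set (M → Q)} {F : I → Finset M}

variable [Preorder I]

theorem closure_finite (hgen : R.IsRightGenerating S) (hsymm : R.IsSymmetricSet S) (hfin : S.Finite)
    (ρ : ℕ) {A : Set M} (hA : A.Finite) : (R.closure S ρ A).Finite := by
  refine (hA.biUnion fun a _ => R.finite_ball hfin a ρ).subset ?_
  rintro m ⟨a, ham, ha⟩
  exact Set.mem_biUnion ha (R.mem_ball_symm hgen hsymm ham)

/-- A net of finite sets meets a separated, relatively dense set of cells with positive density,
even if a margin is left at the boundary. -/
theorem IsRightFolnerNet.eventually_card_le (hgen : R.IsRightGenerating S)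
    (hsymm : R.IsSymmetricSet S) (hfin : S.Finite) (hF : R.IsRightFolnerNet S F) {T : Set M}
    {r : ℕ} (hT : ∀ m, ∃ t ∈ T, m ∈ R.ball S t r) (ρ : ℕ) :
    ∀ᶠ i in atTop, ∃ T' : Finset M, (T' : Set M) ⊆ T ∧ (∀ t ∈ T', R.ball S t ρ ⊆ (F i : Set M)) ∧
      (F i).card ≤ 2 * (R.ball S R.origin r).ncard * T'.card := by
  classical
  -- Eventually less than half of `F i` lies in its `(ρ + r)`-boundary. The other cells are covered
  -- by `r`-balls about centres with margin `ρ`; this gives the factor `2`.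
  filter_upwards [(hF.2 (ρ + r)).eventually (gt_mem_nhds (half_pos one_pos))] with i hi
  have hpos : (0 : ℝ) < (F i).card := by exact_mod_cast (hF.1 i).card_pos
  rw [div_lt_iff₀ hpos] at hi
  set B := R.boundary S (ρ + r) (F i : Set M) with hB
  have hBfin : B.Finite := (closure_finite hgen hsymm hfin _ (F i).finite_toSet).sdiff
  refine ⟨(F i).filter fun t => t ∈ T ∧ R.ball S t ρ ⊆ (F i : Set M),
    fun t ht => (Finset.mem_filter.1 ht).2.1, fun t ht => (Finset.mem_filter.1 ht).2.2, ?_⟩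
  set T' := (F i).filter fun t => t ∈ T ∧ R.ball S t ρ ⊆ (F i : Set M) with hT'
  have hcover : (F i : Set M) ⊆ B ∪ ⋃ t ∈ T', R.ball S t r := by
    intro m hm
    by_cases hmi : R.ball S m (ρ + r) ⊆ (F i : Set M)
    · obtain ⟨t, ht, hmt⟩ := hT m
      have htF : R.ball S t ρ ⊆ (F i : Set M) := fun n hn => hmi <| by
        rw [add_comm]
        exact R.mem_ball_trans (R.mem_ball_symm hgen hsymm hmt) hn
      exact .inr (Set.mem_biUnion (Finset.mem_filter.2 ⟨htF (R.mem_ball_self t ρ), ht, htF⟩) hmt)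
    · exact .inl ⟨⟨m, R.mem_ball_self _ _, hm⟩, fun h => hmi h.2⟩
  have hcard : (F i).card ≤ B.ncard + T'.card * (R.ball S R.origin r).ncard := by
    rw [← Set.ncard_coe_finset]
    have hfin' : (⋃ t ∈ T', R.ball S t r).Finite :=
      T'.finite_toSet.biUnion fun t _ => R.finite_ball hfin t r
    refine (Set.ncard_le_ncard hcover (hBfin.union hfin')).trans
      ((Set.ncard_union_le _ _).trans (Nat.add_le_add_left ?_ _))
    refine (Finset.set_ncard_biUnion_le T' _).trans ?_
    simp [R.ncard_ball hgen]
  have hcard' : ((F i).card : ℝ) ≤ B.ncard + T'.card * (R.ball S R.origin r).ncard := by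
    exact_mod_cast hcard
  have : ((F i).card : ℝ) ≤ 2 * (R.ball S R.origin r).ncard * T'.card := by linarith
  exact_mod_cast this

theorem log_ncard_patterns_div_nonneg (X : Set (M → Q)) (A : Finset M) :
    0 ≤ Real.log (patterns X (A : Set M)).ncard / A.card :=
  div_nonneg (Real.log_natCast_nonneg _) (Nat.cast_nonneg _)

variable [Finite Q]

theorem log_ncard_patterns_div_le (X : Set (M → Q)) (A : Finset M) :
    Real.log (patterns X (A : Set M)).ncard / A.card ≤ Real.log (Nat.card Q) := by
  refine div_le_of_le_mul₀ (Nat.cast_nonneg _) (Real.log_natCast_nonneg _) ?_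
  -- `X` may be empty; then the default value `log 0 = 0` satisfies the bound.
  rcases Nat.eq_zero_or_pos (patterns X (A : Set M)).ncard with h | h
  · rw [h]
    simpa using mul_nonneg (Real.log_natCast_nonneg _) (Nat.cast_nonneg (α := ℝ) A.card)
  · rw [mul_comm, ← Real.log_pow]
    refine Real.log_le_log (by exact_mod_cast h) ?_
    have := ncard_patterns_le_pow X A.finite_toSet
    rw [Set.ncard_coe_finset] at this
    exact_mod_cast this

variable [IsDirectedOrder I] [Nonempty I]

theorem entropy_le_of_eventually_le {w : I → ℝ} {c : ℝ} (hw : Tendsto w atTop (𝓝 c))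
    (h : ∀ᶠ i in atTop, Real.log (patterns Z (F i : Set M)).ncard / (F i).card ≤
      Real.log (patterns X (F i : Set M)).ncard / (F i).card + w i) :
    entropy F Z ≤ entropy F X + c :=
  limsup_le_limsup_add
    (isBoundedUnder_of ⟨0, fun _ => log_ncard_patterns_div_nonneg _ _⟩)
    (isBoundedUnder_of ⟨_, fun _ => log_ncard_patterns_div_le _ _⟩) hw h

/-- Boundary factors do not contribute to the entropy. -/
theorem IsRightFolnerNet.entropy_le (hF : R.IsRightFolnerNet S F) (ρ : ℕ) (hX : X.Nonempty)
    (hZ : Z.Nonempty)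
    (h : ∀ i, (patterns Z (F i : Set M)).ncard ≤
      (patterns X (F i : Set M)).ncard * Nat.card Q ^ (R.boundary S ρ (F i : Set M)).ncard) :
    entropy F Z ≤ entropy F X := by
  have hw := (hF.2 ρ).mul_const (Real.log (Nat.card Q))
  rw [zero_mul] at hw
  rw [← add_zero (entropy F X)]
  refine entropy_le_of_eventually_le hw (Eventually.of_forall fun i => ?_)
  have hX0 := ncard_patterns_pos hX (F i).finite_toSet
  have hZ0 := ncard_patterns_pos hZ (F i).finite_toSet
  have hQ0 : 0 < Nat.card Q ^ (R.boundary S ρ (F i : Set M)).ncard :=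
    Nat.pos_of_mul_pos_left (hZ0.trans_le (h i))
  rw [div_mul_eq_mul_div, ← add_div]
  gcongr
  rw [← Real.log_pow, ← Real.log_mul (by positivity) (by exact_mod_cast hQ0.ne')]
  exact Real.log_le_log (by positivity) (by exact_mod_cast h i)

/-- Avoiding, at each cell of a relatively dense set, some allowed pattern lowers the entropy of a
strongly irreducible space. -/
theorem IsStronglyIrreducibleWith.entropy_lt (hgen : R.IsRightGenerating S)
    (hsymm : R.IsSymmetricSet S) (hfin : S.Finite) (hF : R.IsRightFolnerNet S F) {κ : ℕ}
    (hX : R.IsStronglyIrreducibleWith H S κ X) (hZX : Z ⊆ X) (hZ : Z.Nonempty) (θ : ℕ) {r : ℕ}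
    {T : Set M} (hsep : ∀ t ∈ T, ∀ t' ∈ T, t ≠ t' → t' ∉ R.ball S t (2 * θ + κ))
    (hT : ∀ m, ∃ t ∈ T, m ∈ R.ball S t r) (p : M → M → Q) (hp : ∀ t ∈ T, p t ∈ X)
    (hZp : ∀ z ∈ Z, ∀ t ∈ T, ¬ Set.EqOn z (p t) (R.ball S t θ)) :
    entropy F Z < entropy F X := by
  set K := Nat.card Q ^ (R.ball S R.origin (θ + κ)).ncard with hK
  set b := (R.ball S R.origin r).ncard with hb
  have hQ : 0 < Nat.card Q := by
    obtain ⟨z, -⟩ := hZ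
    have : Nonempty Q := ⟨z R.origin⟩
    exact Nat.card_pos
  have hK0 : 0 < K := pow_pos hQ _
  have hb0 : 0 < b := by
    rw [hb, Set.ncard_pos (R.finite_ball hfin _ _)]
    exact ⟨_, R.mem_ball_self R.origin r⟩
  set L := Real.log (K + 1) - Real.log K with hL
  have hL0 : 0 < L := sub_pos.2 (Real.log_lt_log (by positivity) (by linarith))
  -- Each centre inside `F i` costs `L` in the logarithm, and there are at least `|F i| / (2 * b)`
  -- of them.
  have key : entropy F Z ≤ entropy F X + -(L / (2 * b)) := by
    refine entropy_le_of_eventually_le tendsto_const_nhds ?_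
    filter_upwards [hF.eventually_card_le hgen hsymm hfin hT (θ + κ)] with i hi
    obtain ⟨T', hT'T, hT'F, hcard⟩ := hi
    have h1 := hX.ncard_patterns_avoiding_le hgen hsymm hfin θ p (F i).finite_toSet T'
      (fun t ht => hp t (hT'T ht)) (fun t ht t' ht' => hsep t (hT'T ht) t' (hT'T ht')) hT'F
    have h2 : (patterns Z (F i : Set M)).ncard ≤ (patterns {x ∈ X | ∀ t ∈ T',
        ¬ Set.EqOn x (p t) (R.ball S t θ)} (F i : Set M)).ncard :=
      ncard_patterns_mono
        (fun z hz => Set.mem_sep (hZX hz) fun t ht => hZp z hz t (hT'T ht)) (F i).finite_toSet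
    have h3 := (Nat.mul_le_mul_left _ h2).trans h1
    rw [← hK] at h3
    have hZ0 := ncard_patterns_pos hZ (F i).finite_toSet
    have hX0 := ncard_patterns_pos (hZ.mono hZX) (F i).finite_toSet
    have h4 : T'.card * Real.log (K + 1) + Real.log (patterns Z (F i : Set M)).ncard ≤
        T'.card * Real.log K + Real.log (patterns X (F i : Set M)).ncard := by
      rw [← Real.log_pow, ← Real.log_pow, ← Real.log_mul (by positivity) (by positivity),
        ← Real.log_mul (by positivity) (by positivity)]
      exact Real.log_le_log (by positivity) (by exact_mod_cast h3)
    have hpos : (0 : ℝ) < (F i).card := by exact_mod_cast (hF.1 i).card_pos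
    have hcard' : ((F i).card : ℝ) ≤ 2 * b * T'.card := by exact_mod_cast hcard
    have hbR : (0 : ℝ) < b := by exact_mod_cast hb0
    have h5 : L / (2 * b) * (F i).card ≤ L * T'.card := by
      rw [div_mul_eq_mul_div, div_le_iff₀ (by positivity)]
      nlinarith
    rw [div_le_iff₀ hpos, add_mul, div_mul_cancel₀ _ hpos.ne']
    nlinarith
  have : 0 < L / (2 * b) := by positivity
  linarith

end CellSpace

/-! ### Local maps and entropy; swapping of patterns. -/

namespace CellSpace

variable {G M Q I : Type*} [Group G] [MulAction G M] {R : CellSpace G M} {S : Set (G ⧸ R.stab)}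
  {H : Subgroup G} {X Y : Set (M → Q)} {F : I → Finset M}

/-- The image on `A` is determined by the `κ`-closure of `A`, which exceeds `A` only by boundary
cells. -/
theorem IsLocalWith.ncard_patterns_image_le [Finite Q] (hgen : R.IsRightGenerating S)
    (hsymm : R.IsSymmetricSet S) (hfin : S.Finite) {κ : ℕ} {Δ : X → Y}
    (hΔ : R.IsLocalWith H S κ Δ) (Z : Set X) {A : Set M} (hA : A.Finite) :
    (patterns ((fun x => (Δ x : M → Q)) '' Z) A).ncard ≤
      (patterns (Subtype.val '' Z) A).ncard * Nat.card Q ^ (R.boundary S κ A).ncard := by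
  have hcl : (R.closure S κ A).Finite := closure_finite hgen hsymm hfin κ hA
  refine le_trans ?_ (ncard_patterns_le_mul (A := R.closure S κ A) _ ?_ hA hcl.sdiff)
  · have := finite_patterns (Subtype.val '' Z) hcl
    rw [patterns, Set.image_image] at this ⊢
    rw [patterns, Set.image_image]
    refine Set.ncard_image_le_of_factor this fun x _ y _ hxy => ?_
    rw [domRestrict_eq_iff] at hxy ⊢
    intro m hm
    exact hΔ.apply_eq_of_eqOn hgen fun n hn =>
      hxy ⟨m, R.mem_ball_symm hgen hsymm hn, hm⟩
  · intro m hm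
    by_cases h : m ∈ R.interior S κ A
    · exact .inl h.1
    · exact .inr ⟨hm, h⟩

/-- Local maps do not increase entropy. -/
theorem IsLocalWith.entropy_image_le [Finite Q] [Preorder I] [IsDirectedOrder I] [Nonempty I]
    (hgen : R.IsRightGenerating S) (hsymm : R.IsSymmetricSet S) (hfin : S.Finite)
    (hF : R.IsRightFolnerNet S F) {κ : ℕ} {Δ : X → Y} (hΔ : R.IsLocalWith H S κ Δ) {Z : Set X}
    (hZ : Z.Nonempty) :
    entropy F ((fun x => (Δ x : M → Q)) '' Z) ≤ entropy F (Subtype.val '' Z) :=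
  hF.entropy_le κ (hZ.image _) (hZ.image _) fun i =>
    hΔ.ncard_patterns_image_le hgen hsymm hfin Z (F i).finite_toSet

section Swap

open Classical in
/-- Replace, in `z`, each copy of `x` on a ball of radius `a` about a cell of `T` by the
corresponding copy of `x'`. -/
noncomputable def swap (R : CellSpace G M) (S : Set (G ⧸ R.stab)) (T : Set M) (a : ℕ) (x x' z : M → Q) : M → Q :=
  fun m =>
    if h : ∃ t ∈ T, m ∈ R.ball S t a ∧ Set.EqOn z (fun n => x ((R.coord t)⁻¹ • n)) (R.ball S t a)
    then x' ((R.coord h.choose)⁻¹ • m) else z m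

variable {T : Set M} {a r ρ : ℕ} {x x' z : M → Q}

/-- Disjointness of the balls makes the centre chosen in `swap` unique. -/
theorem swap_apply_of_eqOn (hsep : ∀ t ∈ T, ∀ t' ∈ T, t ≠ t' →
    Disjoint (R.ball S t a) (R.ball S t' a)) {t : M} (ht : t ∈ T)
    (hz : Set.EqOn z (fun n => x ((R.coord t)⁻¹ • n)) (R.ball S t a)) {m : M}
    (hm : m ∈ R.ball S t a) : R.swap S T a x x' z m = x' ((R.coord t)⁻¹ • m) := by
  have h : ∃ t ∈ T, m ∈ R.ball S t a ∧
      Set.EqOn z (fun n => x ((R.coord t)⁻¹ • n)) (R.ball S t a) := ⟨t, ht, hm, hz⟩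
  have ht' : h.choose = t := by
    by_contra hne
    exact Set.disjoint_left.1 (hsep _ h.choose_spec.1 _ ht hne) h.choose_spec.2.1 hm
  rw [swap, dif_pos h, ht']

theorem swap_apply_of_not_eqOn (hsep : ∀ t ∈ T, ∀ t' ∈ T, t ≠ t' →
    Disjoint (R.ball S t a) (R.ball S t' a)) {t : M} (ht : t ∈ T)
    (hz : ¬ Set.EqOn z (fun n => x ((R.coord t)⁻¹ • n)) (R.ball S t a)) {m : M}
    (hm : m ∈ R.ball S t a) : R.swap S T a x x' z m = z m := by
  refine dif_neg ?_
  rintro ⟨t', ht', hm', hz'⟩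
  obtain rfl | hne := eq_or_ne t t'
  · exact hz hz'
  · exact Set.disjoint_left.1 (hsep _ ht _ ht' hne) hm hm'

theorem not_eqOn_swap (hgen : R.IsRightGenerating S) (hsep : ∀ t ∈ T, ∀ t' ∈ T, t ≠ t' →
    Disjoint (R.ball S t a) (R.ball S t' a)) {d : M} (hd : x d ≠ x' d)
    (hda : d ∈ R.ball S R.origin a) {t : M} (ht : t ∈ T) :
    ¬ Set.EqOn (R.swap S T a x x' z) (fun n => x ((R.coord t)⁻¹ • n)) (R.ball S t a) := by
  intro h
  by_cases hz : Set.EqOn z (fun n => x ((R.coord t)⁻¹ • n)) (R.ball S t a)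
  · have hdt : R.coord t • d ∈ R.ball S t a := by
      rwa [← R.coord_inv_smul_mem_ball_iff hgen, inv_smul_smul]
    have := h hdt
    rw [swap_apply_of_eqOn hsep ht hz hdt] at this
    simp only [inv_smul_smul] at this
    exact hd this.symm
  · exact hz fun m hm => (swap_apply_of_not_eqOn hsep ht hz hm).symm.trans (h hm)

/-- Locally, a swapped point looks like the original one or like a copy of `x'` where the original
one looked like a copy of `x`. -/
theorem swap_eqOn_ball (hgen : R.IsRightGenerating S) (hsymm : R.IsSymmetricSet S)
    (hsep : ∀ t ∈ T, ∀ t' ∈ T, t ≠ t' → Disjoint (R.ball S t a) (R.ball S t' a))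
    (hr : ∀ m, x m ≠ x' m → m ∈ R.ball S R.origin r) (ha : r + ρ + ρ ≤ a) (m : M) :
    Set.EqOn (R.swap S T a x x' z) z (R.ball S m ρ) ∨
      ∃ t, Set.EqOn (R.swap S T a x x' z) (fun n => x' ((R.coord t)⁻¹ • n)) (R.ball S m ρ) ∧
        Set.EqOn z (fun n => x ((R.coord t)⁻¹ • n)) (R.ball S m ρ) := by
  -- A ball of radius `ρ` that meets the `r`-core of a swapped copy lies in its `a`-ball, as `r + ρ
  -- + ρ ≤ a`. A ball that meets no such core sees no change, since `x` and `x'` agree off the core.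
  by_cases h : ∃ t ∈ T, Set.EqOn z (fun n => x ((R.coord t)⁻¹ • n)) (R.ball S t a) ∧
      (R.ball S m ρ ∩ R.ball S t r).Nonempty
  · obtain ⟨t, ht, hz, n, hnm, hnt⟩ := h
    have hsub : R.ball S m ρ ⊆ R.ball S t a := fun k hk => R.ball_subset_ball t ha
      (R.mem_ball_trans (R.mem_ball_trans hnt (R.mem_ball_symm hgen hsymm hnm)) hk)
    exact .inr ⟨t, fun k hk => swap_apply_of_eqOn hsep ht hz (hsub hk), hz.mono hsub⟩
  · refine .inl fun n hn => ?_
    by_cases hn' : ∃ t ∈ T, n ∈ R.ball S t a ∧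
        Set.EqOn z (fun n => x ((R.coord t)⁻¹ • n)) (R.ball S t a)
    · obtain ⟨t, ht, hnt, hz⟩ := hn'
      rw [swap_apply_of_eqOn hsep ht hz hnt, hz hnt]
      by_contra hne
      refine h ⟨t, ht, hz, n, hn, ?_⟩
      exact (R.coord_inv_smul_mem_ball_iff hgen).1 (hr _ (Ne.symm hne))
    · exact dif_neg hn'

end Swap

/-! ### The two implications. -/

variable [Finite Q] [Preorder I] [IsDirectedOrder I] [Nonempty I]

/-- Moore's theorem: surjective local maps onto a space of the same entropy are pre-injective. -/
theorem isPreInjective_of_surjective (hgen : R.IsRightGenerating S) (hsymm : R.IsSymmetricSet S)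
    (hfin : S.Finite) (hH : R.IsBig H) (hF : R.IsRightFolnerNet S F)
    (hXft : R.IsSubshiftOfFiniteType H X) (hXirr : R.IsStronglyIrreducible H S X)
    (hent : entropy F X ≤ entropy F Y) {Δ : X → Y} (hΔ : R.IsLocal H S Δ)
    (hsurj : Function.Surjective Δ) : IsPreInjective Δ := by
  intro x x' hdiff himg
  by_contra hne
  obtain ⟨κ, hκ⟩ := hXirr
  obtain ⟨ρ₁, hρ₁⟩ := hXft.exists_memory hgen hsymm
  obtain ⟨ρ₂, hρ₂⟩ := hΔ
  obtain ⟨r, hr⟩ := R.exists_subset_ball hgen hsymm hdiff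
  have hr : ∀ m, (x : M → Q) m ≠ (x' : M → Q) m → m ∈ R.ball S R.origin r := fun m hm => hr hm
  obtain ⟨d, hd⟩ : ∃ d, (x : M → Q) d ≠ (x' : M → Q) d := by
    by_contra! h
    exact hne (Subtype.ext (funext h))
  have hsub := hXft.isSubshift
  set ρ := max ρ₁ ρ₂ with hρ
  set a := r + ρ + ρ with ha
  -- This separation makes the `a`-balls disjoint for `swap` and is what `entropy_lt` asks for with
  -- `θ = a`.
  obtain ⟨T, hT, hTcov⟩ := exists_separated_cover hgen hsymm (2 * a + κ)
  have hsep : ∀ t ∈ T, ∀ t' ∈ T, t ≠ t' → Disjoint (R.ball S t a) (R.ball S t' a) := by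
    refine fun t ht t' ht' htt => Set.disjoint_left.2 fun m hm hm' => hT t ht t' ht' htt ?_
    exact R.ball_subset_ball t (by omega)
      (R.mem_ball_trans hm (R.mem_ball_symm hgen hsymm hm'))
  have hmem : ∀ z : X, R.swap S T a x x' z ∈ X := fun z => hρ₁ _ fun m => by
    obtain h | ⟨t, h, -⟩ := swap_eqOn_ball (z := z) hgen hsymm hsep hr ha.ge m
    · exact ⟨z, z.2, h.mono (R.ball_subset_ball m (le_max_left _ _))⟩
    · exact ⟨_, hsub.comp_smul_mem (H.inv_mem (hH t)) x'.2,
        h.mono (R.ball_subset_ball m (le_max_left _ _))⟩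
  have himage : ∀ z : X, Δ ⟨_, hmem z⟩ = Δ z := fun z => by
    refine Subtype.ext (funext fun m => ?_)
    have hball := R.ball_subset_ball (S := S) m (le_max_right ρ₁ ρ₂)
    -- Near `m` either nothing changed, or a copy of `x` became one of `x'`; translates of `x` and
    -- `x'` have equal images.
    obtain h | ⟨t, h, h'⟩ := swap_eqOn_ball (z := z) hgen hsymm hsep hr ha.ge m
    · exact hρ₂.apply_eq_of_eqOn hgen (h.mono hball)
    · have ht := H.inv_mem (hH t)
      rw [hρ₂.apply_eq_of_eqOn hgen (x := ⟨_, hmem z⟩) (x' := ⟨_, hsub.comp_smul_mem ht x'.2⟩)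
          (h.mono hball), hρ₂.apply_smul hH hsub ht,
        hρ₂.apply_eq_of_eqOn hgen (x := z) (x' := ⟨_, hsub.comp_smul_mem ht x.2⟩)
          (h'.mono hball), hρ₂.apply_smul hH hsub ht, himg]
  set Z : Set X := Set.range fun z : X => (⟨_, hmem z⟩ : X) with hZ
  have hZne : Z.Nonempty := ⟨_, x, rfl⟩
  have hlt : entropy F (Subtype.val '' Z) < entropy F X := by
    refine hκ.entropy_lt hgen hsymm hfin hF (Subtype.coe_image_subset _ _) (hZne.image _) a hT hTcov
      (fun t n => (x : M → Q) ((R.coord t)⁻¹ • n))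
      (fun t _ => hsub.comp_smul_mem (H.inv_mem (hH t)) x.2) ?_
    rintro _ ⟨_, ⟨z, rfl⟩, rfl⟩ t ht
    exact not_eqOn_swap hgen hsep hd
      (R.ball_subset_ball _ (by omega) (hr d hd)) ht
  have hYZ : (fun x => (Δ x : M → Q)) '' Z = Y := by
    ext y
    constructor
    · rintro ⟨w, -, rfl⟩
      exact (Δ w).2
    · intro hy
      obtain ⟨z, hz⟩ := hsurj ⟨y, hy⟩
      exact ⟨_, ⟨z, rfl⟩, by simp only [himage, hz]⟩
  have hle := hρ₂.entropy_image_le hgen hsymm hfin hF hZne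
  rw [hYZ] at hle
  exact absurd (hent.trans hle) (not_le.2 hlt)

/-- Myhill's theorem: pre-injective local maps to a strongly irreducible space of at most the same
entropy are surjective. -/
theorem surjective_of_isPreInjective (hgen : R.IsRightGenerating S) (hsymm : R.IsSymmetricSet S)
    (hfin : S.Finite) (hH : R.IsBig H) (hF : R.IsRightFolnerNet S F) (hXne : X.Nonempty)
    (hX : R.IsSubshift H X) (hXirr : R.IsStronglyIrreducible H S X)
    (hY : R.IsSubshift H Y) (hYirr : R.IsStronglyIrreducible H S Y)
    (hent : entropy F Y ≤ entropy F X) {Δ : X → Y} (hΔ : R.IsLocal H S Δ)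
    (hinj : IsPreInjective Δ) : Function.Surjective Δ := by
  by_contra hsurj
  simp only [Function.Surjective, not_forall] at hsurj
  obtain ⟨y, hy⟩ := hsurj
  obtain ⟨κX, hκX⟩ := hXirr
  obtain ⟨κY, hκY⟩ := hYirr
  obtain ⟨ρ, hρ⟩ := hΔ
  obtain ⟨x₀, hx₀⟩ := hXne
  obtain ⟨A, hA, hyA⟩ : ∃ A : Set M, A.Finite ∧ ∀ x, ¬ Set.EqOn (Δ x : M → Q) y A := by
    by_contra! h
    exact hy (hρ.mem_range_of_forall_finite hgen hfin hX y h)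
  obtain ⟨θ, hθ⟩ := R.exists_subset_ball hgen hsymm hA
  obtain ⟨T, hT, hTcov⟩ := exists_separated_cover hgen hsymm (2 * θ + κY)
  set Z : Set (M → Q) := Set.range fun x => (Δ x : M → Q) with hZ
  have hZne : Z.Nonempty := ⟨_, ⟨x₀, hx₀⟩, rfl⟩
  have hlt : entropy F Z < entropy F Y := by
    refine hκY.entropy_lt hgen hsymm hfin hF (by rintro _ ⟨x, rfl⟩; exact (Δ x).2) hZne θ hT hTcov
      (fun t n => (y : M → Q) ((R.coord t)⁻¹ • n))
      (fun t _ => hY.comp_smul_mem (H.inv_mem (hH t)) y.2) ?_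
    rintro _ ⟨x, rfl⟩ t - h
    -- An occurrence at `t` is moved back to the origin by equivariance.
    refine hyA ⟨_, hX.comp_smul_mem (hH t) x.2⟩ fun m hm => ?_
    rw [hρ.apply_smul hH hX (hH t)]
    have := h ((R.coord_inv_smul_mem_ball_iff hgen (t := t) (m := R.coord t • m)).1
      (by simpa using hθ hm))
    simpa using this
  -- Points that agree off the `κX`-closure of `F i` have images that agree off its `σ`-closure.
  set σ := κX + ρ with hσ
  obtain ⟨i, hi⟩ : ∃ i, (patterns Z (F i : Set M)).ncard *
      Nat.card Q ^ (R.boundary S σ (F i : Set M)).ncard < (patterns X (F i : Set M)).ncard := by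
    by_contra! h
    exact absurd (hent.trans (hF.entropy_le σ hZne ⟨x₀, hx₀⟩ h)) (not_le.2 hlt)
  have hFfin : (F i : Set M).Finite := (F i).finite_toSet
  have hcl := fun k => closure_finite hgen hsymm hfin k hFfin
  have hext : ∀ x : X, ∃ z : X, Set.EqOn (z : M → Q) x (F i) ∧
      Set.EqOn (z : M → Q) x₀ (R.closure S κX (F i : Set M))ᶜ := fun x => by
    obtain ⟨z, hz, h1, h2⟩ := hκX.exists_eqOn_of_finite hX x.2 hx₀ hFfin
      (A' := (R.closure S κX (F i : Set M))ᶜ)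
      (fun a ha b hb hab => hb ⟨a, R.mem_ball_symm hgen hsymm hab, ha⟩)
    exact ⟨⟨z, hz⟩, h1, h2⟩
  choose e heF he0 using hext
  have hinj' : ∀ x x' : X,
      Set.EqOn (Δ (e x) : M → Q) (Δ (e x')) (R.closure S σ (F i : Set M)) → e x = e x' := by
    intro x x' h
    refine hinj _ _ ((hcl κX).subset fun m hm => ?_) (Subtype.ext (funext fun m => ?_))
    · by_contra hm'
      exact hm ((he0 x hm').trans (he0 x' hm').symm)
    · by_cases hm : m ∈ R.closure S σ (F i : Set M)
      · exact h hm
      · refine hρ.apply_eq_of_eqOn hgen fun n hn => ?_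
        have hn' : n ∈ (R.closure S κX (F i : Set M))ᶜ := by
          rintro ⟨f, hnf, hf⟩
          exact hm ⟨f, R.ball_subset_ball m (by omega) (R.mem_ball_trans hn hnf), hf⟩
        exact (he0 x hn').trans (he0 x' hn').symm
  -- Pigeonhole: by `hinj'`, a pattern of `X` on `F i` can be recovered from the image of its
  -- extension on the `σ`-closure.
  refine absurd hi (not_lt.2 ?_)
  calc (patterns X (F i : Set M)).ncard
      = ((fun x : X => (F i : Set M).domRestrict (x : M → Q)) '' Set.univ).ncard := by
        rw [patterns, Set.image_univ, Set.image_eq_range]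
    _ ≤ ((fun x : X => (R.closure S σ (F i : Set M)).domRestrict (Δ (e x) : M → Q)) ''
          Set.univ).ncard := by
        have : Finite (R.closure S σ (F i : Set M)) := hcl σ
        refine Set.ncard_image_le_of_factor (Set.toFinite _) fun x _ x' _ h => ?_
        have := hinj' x x' (domRestrict_eq_iff.1 h)
        exact domRestrict_eq_iff.2 ((heF x).symm.trans (this ▸ heF x'))
    _ ≤ (patterns Z (R.closure S σ (F i : Set M))).ncard := by
        refine Set.ncard_le_ncard ?_ (finite_patterns Z (hcl σ))
        rintro _ ⟨x, -, rfl⟩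
        exact ⟨_, ⟨e x, rfl⟩, rfl⟩
    _ ≤ _ := by
        refine ncard_patterns_le_mul Z (fun m hm => ?_) hFfin (hcl σ).sdiff
        by_cases h : m ∈ R.interior S σ (F i : Set M)
        · exact .inl h.1
        · exact .inr ⟨hm, h⟩

end CellSpace

theorem mainTheorem1 {G M Q I : Type*} [Group G] [MulAction G M] [Finite Q]
    [Preorder I] [IsDirectedOrder I] [Nonempty I]
    (R : CellSpace G M) (hG₀ : Finite R.stab)
    (S : Set (G ⧸ R.stab)) (hSfin : S.Finite) (hSgen : R.IsRightGenerating S)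
    (hSsymm : R.IsSymmetricSet S)
    (H : Subgroup G) (hH : R.IsBig H)
    (hR : R.IsRightAmenable)
    (F : I → Finset M) (hF : R.IsRightFolnerNet S F)
    (X Y : Set (M → Q)) (hXne : X.Nonempty)
    (hXft : R.IsSubshiftOfFiniteType H X) (hXirr : R.IsStronglyIrreducible H S X)
    (hY : R.IsSubshift H Y) (hYirr : R.IsStronglyIrreducible H S Y)
    (hent : CellSpace.entropy F X = CellSpace.entropy F Y)
    (Δ : X → Y) (hΔ : R.IsLocal H S Δ) :
    Function.Surjective Δ ↔ CellSpace.IsPreInjective Δ := by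
  constructor
  · exact CellSpace.isPreInjective_of_surjective hSgen hSsymm hSfin hH hF hXft hXirr hent.le hΔ
  · exact CellSpace.surjective_of_isPreInjective hSgen hSsymm hSfin hH hF hXne hXft.isSubshift hXirr
      hY hYirr hent.ge hΔ
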